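/- For a finite simple graph $G$ with adjacency matrix $A(G)$ and diagonal degree matrix $D(G)$, let $L(G)=D(G)-A(G)$ be its Laplacian matrix. Two finite simple graphs are called $L$-cospectral if their Laplacian matrices have the same multiset of eigenvalues, and $G$ is called DLS (determined by its Laplacian spectrum) if every finite simple graph that is $L$-cospectral with $G$ is isomorphic to $G$. For integers $p\ge 0$ and $q\ge 3$, the jellyfish graph $JFG(p,q)$ is the graph obtained from the cycle $C_q$ and $q$ copies of the star $K_{1,p}$ by identifying each vertex of $C_q$ with the centre of its own copy of $K_{1,p}$ (so $JFG(0,q)=C_q$). Let $p\ge 0$ and $q\ge 3$ be integers with $q$ even, and let $H$ be a finite simple graph that is $L$-cospectral with $JFG(p,q)$. Then the complement $\overline{H}$ of $H$ is DLS. -/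

import Mathlib

universe u v

/-- The Laplacian spectrum of a finite simple graph: the multiset of the eigenvalues of its Laplacian
matrix `D - A`, each repeated according to its multiplicity. (All of them are real, because the
matrix is real symmetric.) -/
noncomputable def laplacianSpectrum {V : Type u} [Fintype V] (G : SimpleGraph V) : Multiset ℝ :=
  open Classical in (G.lapMatrix ℝ).charpoly.roots

/-- Two finite graphs are `L`-cospectral if they have the same Laplacian spectrum. -/
def LCospectral {V : Type u} {W : Type v} [Fintype V] [Fintype W]
    (G : SimpleGraph V) (K : SimpleGraph W) : Prop :=
  laplacianSpectrum G = laplacianSpectrum K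

/-- `G` is DLS, determined by its Laplacian spectrum: every finite graph that is `L`-cospectral
with `G` is isomorphic to `G`. -/
def IsDLS {V : Type u} [Fintype V] (G : SimpleGraph V) : Prop :=
  ∀ (W : Type v) [Fintype W] (K : SimpleGraph W), LCospectral K G → Nonempty (K ≃g G)

/-- The jellyfish graph `JFG(p, q)`: `q` copies of the star `K_{1,p}` and a cycle `C_q`, where the
`i`-th vertex of the cycle is merged with the centre of the `i`-th star. The `i`-th star is
`{i} × Option (Fin p)` with centre `(i, none)`. -/
def jellyfishGraph (p q : ℕ) : SimpleGraph (Fin q × Option (Fin p)) where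
  Adj x y :=
    (x.2 = none ∧ y.2 = none ∧ (SimpleGraph.cycleGraph q).Adj x.1 y.1) ∨
      (x.1 = y.1 ∧ (SimpleGraph.starGraph (none : Option (Fin p))).Adj x.2 y.2)
  symm := ⟨by
    rintro x y (⟨hx, hy, h⟩ | ⟨h, h'⟩)
    · exact Or.inl ⟨hy, hx, h.symm⟩
    · exact Or.inr ⟨h.symm, h'.symm⟩⟩
  loopless := ⟨by
    rintro x (⟨_, _, h⟩ | ⟨_, h⟩)
    · exact h.ne rfl
    · exact h.ne rfl⟩

/-! The Laplacian spectrum of a graph determines that of its complement, so it suffices that `JFG(p,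
q)` itself is DLS for even `q`: a graph cospectral with `Hᶜ` has its complement cospectral with `H`,
and both are then the jellyfish graph.

Let `G` be cospectral with the jellyfish graph. The spectrum fixes the numbers of vertices, edges,
components and spanning trees, so `G` is connected and unicyclic, with an even number of spanning
trees. A unicyclic graph has as many spanning trees as its cycle has vertices; hence `G` has no
triangle (`no_triangle_of_det_groundedLapMatrix_eq_zero`, carried out modulo two).

For triangle-free graphs the first three spectral moments determine `∑ (d - 1) (d - (p + 2)) ^ 2`
over the degrees `d`. This sum vanishes for the jellyfish graph and has nonnegative terms for `G`,
so every degree is `1` or `p + 2` (`degree_eq_one_or_of_charpoly_eq`), and exactly `q` vertices are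
not leaves.

Eliminating the leaves from the characteristic polynomial near `1` shows that the product of the
leaf counts at the non-leaves is `p ^ q` (`prod_leafCount_eq`). Their sum is `q * p`, so by equality
in AM-GM each count is `p`. Deleting the leaves therefore leaves a connected 2-regular graph on `q`
vertices, which is `C_q`. -/

open Matrix SimpleGraph Polynomial

/-! ### Spectral invariants: order, power sums, connectedness -/

section Spectrum

variable {V W : Type*} [Fintype V] [Fintype W] [DecidableEq V] [DecidableEq W]

theorem laplacianSpectrum_eq_roots (G : SimpleGraph V) [DecidableRel G.Adj] :
    laplacianSpectrum G = (G.lapMatrix ℝ).charpoly.roots := by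
  unfold laplacianSpectrum
  congr!

theorem charpoly_eq_of_roots_eq {A : Matrix V V ℝ} {B : Matrix W W ℝ} (hA : A.IsHermitian)
    (hB : B.IsHermitian) (h : A.charpoly.roots = B.charpoly.roots) : A.charpoly = B.charpoly := by
  rw [hA.splits_charpoly.eq_prod_roots_of_monic A.charpoly_monic,
    hB.splits_charpoly.eq_prod_roots_of_monic B.charpoly_monic, h]

theorem lCospectral_iff_charpoly_eq (G : SimpleGraph V) (K : SimpleGraph W) [DecidableRel G.Adj]
    [DecidableRel K.Adj] :
    LCospectral G K ↔ (G.lapMatrix ℝ).charpoly = (K.lapMatrix ℝ).charpoly := by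
  rw [LCospectral, laplacianSpectrum_eq_roots, laplacianSpectrum_eq_roots]
  exact ⟨charpoly_eq_of_roots_eq (G.isHermitian_lapMatrix ℝ) (K.isHermitian_lapMatrix ℝ),
    fun h ↦ by rw [h]⟩

theorem card_eq_of_charpoly_eq {A : Matrix V V ℝ} {B : Matrix W W ℝ}
    (h : A.charpoly = B.charpoly) : Fintype.card V = Fintype.card W := by
  rw [← A.charpoly_natDegree_eq_dim, h, B.charpoly_natDegree_eq_dim]

theorem Matrix.IsHermitian.trace_pow_eq_sum_eigenvalues {A : Matrix V V ℝ} (hA : A.IsHermitian)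
    (k : ℕ) : (A ^ k).trace = ∑ i, hA.eigenvalues i ^ k := by
  conv_lhs => rw [hA.spectral_theorem, ← map_pow, Unitary.conjStarAlgAut_apply,
    Matrix.trace_mul_comm, ← mul_assoc]
  simp [Matrix.diagonal_pow, Matrix.trace_diagonal]

theorem Matrix.IsHermitian.trace_pow_eq_sum_roots {A : Matrix V V ℝ} (hA : A.IsHermitian) (k : ℕ) :
    (A ^ k).trace = (A.charpoly.roots.map (· ^ k)).sum := by
  rw [hA.trace_pow_eq_sum_eigenvalues, hA.roots_charpoly_eq_eigenvalues, Multiset.map_map]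
  rfl

theorem Matrix.IsHermitian.rank_eq_countP_roots {A : Matrix V V ℝ} (hA : A.IsHermitian) :
    A.rank = A.charpoly.roots.countP (· ≠ 0) := by
  rw [hA.rank_eq_card_non_zero_eigs, hA.roots_charpoly_eq_eigenvalues, Multiset.countP_map,
    Fintype.card_subtype]
  rfl

theorem rank_lapMatrix_add_card_connectedComponent (G : SimpleGraph V) [DecidableRel G.Adj] :
    (G.lapMatrix ℝ).rank + Nat.card G.ConnectedComponent = Fintype.card V := by
  have := (G.lapMatrix ℝ).toLin'.finrank_range_add_finrank_ker
  rw [Nat.card_eq_fintype_card, G.card_connectedComponent_eq_finrank_ker_toLin'_lapMatrix]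
  rwa [Module.finrank_fintype_fun_eq_card] at this

/-- The number of components is the nullity of the Laplacian, which for a Hermitian matrix is the
multiplicity of the root `0`. -/
theorem connected_of_charpoly_eq {G : SimpleGraph V} {K : SimpleGraph W} [DecidableRel G.Adj]
    [DecidableRel K.Adj] (h : (G.lapMatrix ℝ).charpoly = (K.lapMatrix ℝ).charpoly)
    (hK : K.Connected) : G.Connected := by
  have hG := rank_lapMatrix_add_card_connectedComponent G
  have hK' := rank_lapMatrix_add_card_connectedComponent K
  rw [(G.isHermitian_lapMatrix ℝ).rank_eq_countP_roots, h,
    ← (K.isHermitian_lapMatrix ℝ).rank_eq_countP_roots, card_eq_of_charpoly_eq h] at hG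
  have h1 : Nat.card K.ConnectedComponent = 1 := by
    rw [Nat.card_eq_one_iff_unique]
    exact ⟨hK.preconnected.subsingleton_connectedComponent,
      ⟨K.connectedComponentMk hK.nonempty.some⟩⟩
  have h2 : Nat.card G.ConnectedComponent = 1 := by omega
  rw [Nat.card_eq_one_iff_unique] at h2
  obtain ⟨h3, ⟨c⟩⟩ := h2
  obtain ⟨v, -⟩ := c.exists_rep
  exact { preconnected := fun a b ↦ ConnectedComponent.exact (Subsingleton.elim _ _)
          nonempty := ⟨v⟩ }

end Spectrum

/-! ### The Laplacian spectrum of the complement -/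

section Complement

variable {V W : Type*} [Fintype V] [Fintype W] [DecidableEq V] [DecidableEq W]

theorem lapMatrix_mul_allOnes {R : Type*} [CommRing R] (G : SimpleGraph V) [DecidableRel G.Adj] :
    G.lapMatrix R * (Matrix.of fun _ _ ↦ 1 : Matrix V V R) = 0 := by
  ext i j
  exact congrFun (G.lapMatrix_mulVec_const_eq_zero (R := R)) i

theorem lapMatrix_compl (G : SimpleGraph V) [DecidableRel G.Adj] :
    Gᶜ.lapMatrix ℝ =
      scalar V (Fintype.card V : ℝ) - G.lapMatrix ℝ - Matrix.of fun _ _ ↦ 1 := by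
  ext i j
  rw [lapMatrix, lapMatrix, degMatrix, degMatrix, scalar_apply]
  simp only [Matrix.sub_apply, diagonal_apply, of_apply, adjMatrix_apply, compl_adj]
  obtain rfl | hij := eq_or_ne i j
  · have h : G.degree i < Fintype.card V := G.degree_lt_card_verts i
    have h' : (Gᶜ.degree i : ℝ) = Fintype.card V - 1 - G.degree i := by
      rw [degree_compl, Nat.sub_sub, Nat.cast_sub (by omega)]
      push_cast
      ring
    simp [h']
    ring
  · by_cases h : G.Adj i j <;> simp [hij, h]

/-- Since `L * J = 0` for the all-ones matrix `J`, the product `(y + L) * (y + J)` collapses to `y •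
(y + L + J)`. -/
theorem pow_mul_det_lapMatrix_add_allOnes (G : SimpleGraph V) [DecidableRel G.Adj] (y : ℝ) :
    y ^ Fintype.card V * (scalar V y + G.lapMatrix ℝ + Matrix.of fun _ _ ↦ 1).det =
      (scalar V y + G.lapMatrix ℝ).det *
        (scalar V y + (Matrix.of fun _ _ ↦ 1 : Matrix V V ℝ)).det := by
  have : (scalar V y + G.lapMatrix ℝ) * (scalar V y + Matrix.of fun _ _ ↦ 1) =
      y • (scalar V y + G.lapMatrix ℝ + Matrix.of fun _ _ ↦ 1) := by
    rw [add_mul, mul_add, mul_add, lapMatrix_mul_allOnes]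
    simp only [scalar_apply, ← smul_one_eq_diagonal, smul_mul_assoc, mul_smul_comm, one_mul,
      mul_one, smul_add, add_zero]
    abel
  rw [← det_mul, this, det_smul]

theorem det_scalar_add_lapMatrix (G : SimpleGraph V) [DecidableRel G.Adj] (y : ℝ) :
    (scalar V y + G.lapMatrix ℝ).det =
      (-1) ^ Fintype.card V * (G.lapMatrix ℝ).charpoly.eval (-y) := by
  rw [eval_charpoly, ← det_neg]
  congr 1
  rw [map_neg]
  abel

theorem eval_charpoly_lapMatrix_compl (G : SimpleGraph V) [DecidableRel G.Adj] (y : ℝ) :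
    (Gᶜ.lapMatrix ℝ).charpoly.eval (y + Fintype.card V) =
      (scalar V y + G.lapMatrix ℝ + Matrix.of fun _ _ ↦ 1).det := by
  rw [eval_charpoly, lapMatrix_compl, map_add]
  congr 1
  abel

/-- With `n` vertices the complement has Laplacian `n - L - J`, so its characteristic polynomial at
`y + n` is `det (y + L + J)`, which for `y ≠ 0` depends only on `n` and the characteristic
polynomial of `L`. -/
theorem charpoly_lapMatrix_compl_eq {G : SimpleGraph V} {K : SimpleGraph W} [DecidableRel G.Adj]
    [DecidableRel K.Adj] (h : (G.lapMatrix ℝ).charpoly = (K.lapMatrix ℝ).charpoly) :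
    (Gᶜ.lapMatrix ℝ).charpoly = (Kᶜ.lapMatrix ℝ).charpoly := by
  have hc := card_eq_of_charpoly_eq h
  apply Polynomial.eq_of_infinite_eval_eq
  refine (Set.finite_singleton (Fintype.card V : ℝ)).infinite_compl.mono fun x hx ↦ ?_
  obtain ⟨y, rfl⟩ : ∃ y, x = y + Fintype.card V := ⟨x - Fintype.card V, by ring⟩
  have hy : y ≠ 0 := by simpa using hx
  have hG := pow_mul_det_lapMatrix_add_allOnes G y
  have hK := pow_mul_det_lapMatrix_add_allOnes K y
  rw [det_scalar_add_lapMatrix, ← eval_charpoly_lapMatrix_compl] at hG hK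
  have hJ : (scalar V y + (Matrix.of fun _ _ ↦ 1 : Matrix V V ℝ)).det =
      (scalar W y + (Matrix.of fun _ _ ↦ 1 : Matrix W W ℝ)).det := by
    let e := Fintype.equivOfCardEq hc
    rw [← det_reindex_self e]
    congr 1
    ext i j
    simp [diagonal_apply]
  rw [h, hc, hJ, ← hK, ← hc] at hG
  simpa [hy, hc] using hG

theorem LCospectral.compl {V : Type*} {W : Type*} [Fintype V] [Fintype W] {G : SimpleGraph V}
    {K : SimpleGraph W} (h : LCospectral G K) : LCospectral Gᶜ Kᶜ := by
  classical
  rw [lCospectral_iff_charpoly_eq] at h ⊢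
  exact charpoly_lapMatrix_compl_eq h

theorem det_lapMatrix_add_allOnes_eq {G : SimpleGraph V} {K : SimpleGraph W} [DecidableRel G.Adj]
    [DecidableRel K.Adj] (h : (G.lapMatrix ℝ).charpoly = (K.lapMatrix ℝ).charpoly) :
    (G.lapMatrix ℝ + Matrix.of fun _ _ ↦ 1).det = (K.lapMatrix ℝ + Matrix.of fun _ _ ↦ 1).det := by
  have hG := eval_charpoly_lapMatrix_compl G 0
  have hK := eval_charpoly_lapMatrix_compl K 0
  rw [charpoly_lapMatrix_compl_eq h, card_eq_of_charpoly_eq h, hK] at hG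
  simpa using hG.symm

end Complement

/-! ### Spanning trees: the grounded Laplacian determinant -/

section ReducedLaplacian

variable {V W : Type*} [Fintype V] [Fintype W] [DecidableEq V] [DecidableEq W]

theorem det_one_add_vecMulVec {R : Type*} [CommRing R] (a b : V → R) :
    (1 + vecMulVec a b).det = 1 + b ⬝ᵥ a := by
  rw [vecMulVec_eq Unit, det_one_add_replicateCol_mul_replicateRow]

/-- Multiplying `M + e eᵀ` by `1 + (u - e) uᵀ` on the left and its transpose on the right gives `M +
u uᵀ`; each factor has determinant `u ⬝ᵥ u`. -/
theorem det_add_vecMulVec_self {R : Type*} [CommRing R] {M : Matrix V V R} {u e : V → R}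
    (hr : M *ᵥ u = 0) (hl : u ᵥ* M = 0) (hue : u ⬝ᵥ e = 1) :
    (M + vecMulVec u u).det = (u ⬝ᵥ u) ^ 2 * (M + vecMulVec e e).det := by
  have heu : e ⬝ᵥ u = 1 := by rw [dotProduct_comm, hue]
  have key : (1 + vecMulVec (u - e) u) * (M + vecMulVec e e) * (1 + vecMulVec u (u - e)) =
      M + vecMulVec u u := by
    simp only [add_mul, mul_add, one_mul, mul_one, vecMulVec_mul, hl, mul_vecMulVec, hr, heu, hue,
      vecMulVec_mulVec, sub_vecMulVec, vecMulVec_sub, sub_mul, mul_sub, vecMulVec_zero,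
      zero_vecMulVec, MulOpposite.op_one, one_smul, zero_mulVec]
    abel
  rw [← key, det_mul, det_mul, det_one_add_vecMulVec, det_one_add_vecMulVec, dotProduct_sub,
    sub_dotProduct, hue, heu]
  ring

theorem map_lapMatrix {R S : Type*} [Ring R] [Ring S] (f : R →+* S) (G : SimpleGraph V)
    [DecidableRel G.Adj] : (G.lapMatrix R).map f = G.lapMatrix S := by
  ext i j
  simp only [lapMatrix, degMatrix, map_apply, Matrix.sub_apply, diagonal_apply, adjMatrix_apply,
    map_sub]
  congr 1 <;> split_ifs <;> simp

theorem one_vecMul_lapMatrix {R : Type*} [CommRing R] (G : SimpleGraph V) [DecidableRel G.Adj] :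
    (fun _ ↦ 1) ᵥ* G.lapMatrix R = 0 := by
  rw [← mulVec_transpose, (G.isSymm_lapMatrix R).eq]
  exact G.lapMatrix_mulVec_const_eq_zero

/-- The Laplacian matrix over `R` with the diagonal entry at `v` increased by one. Its determinant
is the number of spanning trees. -/
def groundedLapMatrix (R : Type*) [CommRing R] (G : SimpleGraph V) [DecidableRel G.Adj] (v : V) :
    Matrix V V R :=
  G.lapMatrix R + vecMulVec (Pi.single v 1) (Pi.single v 1)

theorem map_det_groundedLapMatrix {R S : Type*} [CommRing R] [CommRing S] (f : R →+* S)
    (G : SimpleGraph V) [DecidableRel G.Adj] (v : V) :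
    f (groundedLapMatrix R G v).det = (groundedLapMatrix S G v).det := by
  rw [RingHom.map_det]
  congr 1
  rw [groundedLapMatrix, groundedLapMatrix, ← map_lapMatrix f G]
  ext i j
  simp [vecMulVec_apply, Pi.single_apply, apply_ite f]

theorem det_lapMatrix_add_allOnes {R : Type*} [CommRing R] (G : SimpleGraph V)
    [DecidableRel G.Adj] (v : V) :
    (G.lapMatrix R + Matrix.of fun _ _ ↦ 1).det =
      (Fintype.card V : R) ^ 2 * (groundedLapMatrix R G v).det := by
  have e : (Matrix.of fun _ _ ↦ 1 : Matrix V V R) = vecMulVec (fun _ ↦ 1) (fun _ ↦ 1) := by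
    ext
    simp [vecMulVec_apply]
  have h := det_add_vecMulVec_self (M := G.lapMatrix R) (u := fun _ ↦ 1) (e := Pi.single v 1)
    G.lapMatrix_mulVec_const_eq_zero (one_vecMul_lapMatrix G) (by simp)
  rw [e, h, groundedLapMatrix]
  simp [dotProduct]

/-- The equality holds over `ℝ`, where the squared order cancels; the determinants come from
integers, so it descends to `ℤ` and passes to any `R`. -/
theorem det_groundedLapMatrix_eq {G : SimpleGraph V} {K : SimpleGraph W} [DecidableRel G.Adj]
    [DecidableRel K.Adj] (h : (G.lapMatrix ℝ).charpoly = (K.lapMatrix ℝ).charpoly) (R : Type*)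
    [CommRing R] (v : V) (w : W) :
    (groundedLapMatrix R G v).det = (groundedLapMatrix R K w).det := by
  have key : (groundedLapMatrix ℝ G v).det = (groundedLapMatrix ℝ K w).det := by
    have := det_lapMatrix_add_allOnes_eq h
    rw [det_lapMatrix_add_allOnes G v, det_lapMatrix_add_allOnes K w,
      card_eq_of_charpoly_eq h] at this
    have hc : (Fintype.card W : ℝ) ≠ 0 := by
      have : Nonempty W := ⟨w⟩
      simp
    exact mul_left_cancel₀ (pow_ne_zero 2 hc) this
  rw [← map_det_groundedLapMatrix (Int.castRingHom ℝ),
    ← map_det_groundedLapMatrix (Int.castRingHom ℝ)] at key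
  rw [← map_det_groundedLapMatrix (Int.castRingHom R),
    ← map_det_groundedLapMatrix (Int.castRingHom R), Int.cast_injective key]

theorem det_groundedLapMatrix_ne_zero {F : Type*} [Field F] (G : SimpleGraph V)
    [DecidableRel G.Adj] (v : V) (h : ∀ f : V → F, G.lapMatrix F *ᵥ f = 0 → ∀ a b, f a = f b) :
    (groundedLapMatrix F G v).det ≠ 0 := by
  rw [Ne, ← exists_mulVec_eq_zero_iff]
  rintro ⟨f, hf, h0⟩
  rw [groundedLapMatrix, add_mulVec, vecMulVec_mulVec] at h0
  -- Summing all coordinates kills the Laplacian term and leaves `f v`.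
  have h1 : f v = 0 := by
    have := congrArg ((fun _ ↦ 1) ⬝ᵥ ·) h0
    simpa [dotProduct_mulVec, one_vecMul_lapMatrix] using this
  rw [single_one_dotProduct, h1] at h0
  refine hf (funext fun a ↦ ?_)
  rw [h f (by simpa using h0) a v, h1, Pi.zero_apply]

theorem det_groundedLapMatrix_eq_zero {F : Type*} [Field F] (G : SimpleGraph V)
    [DecidableRel G.Adj] (v : V) {f : V → F} (hf : f ≠ 0) (h : G.lapMatrix F *ᵥ f = 0)
    (hv : f v = 0) : (groundedLapMatrix F G v).det = 0 := by
  rw [← exists_mulVec_eq_zero_iff]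
  refine ⟨f, hf, ?_⟩
  rw [groundedLapMatrix, add_mulVec, vecMulVec_mulVec, h, single_one_dotProduct, hv]
  simp

end ReducedLaplacian

/-! ### Excluding triangles modulo two -/

section Triangle

variable {V : Type*} [Fintype V] [DecidableEq V]

/-- The incidence matrix modulo two, with one column for each edge. -/
def edgeIncMatrix (G : SimpleGraph V) [DecidableRel G.Adj] : Matrix V G.edgeSet (ZMod 2) :=
  (G.incMatrix (ZMod 2)).submatrix id Subtype.val

theorem edgeIncMatrix_mul_transpose (G : SimpleGraph V) [DecidableRel G.Adj] :
    edgeIncMatrix G * (edgeIncMatrix G)ᵀ = G.lapMatrix (ZMod 2) := by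
  have h : edgeIncMatrix G * (edgeIncMatrix G)ᵀ =
      G.incMatrix (ZMod 2) * (G.incMatrix (ZMod 2))ᵀ := by
    ext a b
    simp only [mul_apply, transpose_apply, edgeIncMatrix, submatrix_apply, id]
    rw [← Finset.sum_subtype G.edgeFinset (fun _ ↦ mem_edgeFinset)
      fun e ↦ G.incMatrix (ZMod 2) a e * G.incMatrix (ZMod 2) b e]
    refine Finset.sum_subset (Finset.subset_univ _) fun e _ he ↦ ?_
    rw [incMatrix_of_notMem_incidenceSet, zero_mul]
    exact fun h ↦ he (mem_edgeFinset.mpr h.1)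
  rw [h, incMatrix_mul_transpose]
  ext a b
  simp only [lapMatrix, degMatrix, Matrix.sub_apply, diagonal_apply, adjMatrix_apply, of_apply]
  by_cases hab : a = b
  · subst hab; simp
  · by_cases h : G.Adj a b <;> simp [hab, h]

theorem edgeIncMatrix_transpose_mulVec (G : SimpleGraph V) [DecidableRel G.Adj]
    (f : V → ZMod 2) {a b : V} (h : G.Adj a b) :
    ((edgeIncMatrix G)ᵀ *ᵥ f) ⟨s(a, b), h⟩ = f a + f b := by
  have : ∀ x, (edgeIncMatrix G)ᵀ ⟨s(a, b), h⟩ x * f x =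
      if x ∈ ({a, b} : Finset V) then f x else 0 := by
    intro x
    simp [edgeIncMatrix, incMatrix_apply', mk'_mem_incidenceSet_iff, h]
  rw [mulVec, dotProduct, Finset.sum_congr rfl fun x _ ↦ this x, Finset.sum_ite_mem,
    Finset.univ_inter, Finset.sum_pair h.ne]

theorem eq_of_edgeIncMatrix_transpose_mulVec_eq_zero {G : SimpleGraph V} [DecidableRel G.Adj]
    (hG : G.Connected) {f : V → ZMod 2} (h : (edgeIncMatrix G)ᵀ *ᵥ f = 0) (a b : V) :
    f a = f b := by
  obtain ⟨w⟩ := hG.preconnected a b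
  induction w with
  | nil => rfl
  | cons hA _ ih =>
    rw [← ih]
    have := edgeIncMatrix_transpose_mulVec G f hA
    rw [h, Pi.zero_apply] at this
    exact (CharTwo.add_eq_zero.mp this.symm)

/-- This kernel is the cycle space. Connectedness makes the rank one less than the number of
vertices, here also the number of edges. -/
theorem finrank_ker_edgeIncMatrix {G : SimpleGraph V} [DecidableRel G.Adj] (hG : G.Connected)
    (hcard : Fintype.card G.edgeSet = Fintype.card V) :
    Module.finrank (ZMod 2) (edgeIncMatrix G).mulVecLin.ker = 1 := by
  have h1 := (edgeIncMatrix G).mulVecLin.finrank_range_add_finrank_ker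
  have h2 := (edgeIncMatrix G)ᵀ.mulVecLin.finrank_range_add_finrank_ker
  have h3 : Module.finrank (ZMod 2) (edgeIncMatrix G)ᵀ.mulVecLin.ker = 1 := by
    refine finrank_eq_one ⟨fun _ ↦ 1, ?_⟩ ?_ ?_
    · rw [LinearMap.mem_ker, mulVecLin_apply]
      ext ⟨e, he⟩
      induction e with | _ a b
      exact (edgeIncMatrix_transpose_mulVec G _ he).trans rfl
    · intro h
      have := congrFun (congrArg Subtype.val h) hG.nonempty.some
      simp at this
    · rintro ⟨f, hf⟩
      refine ⟨f hG.nonempty.some, Subtype.ext (funext fun a ↦ ?_)⟩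
      simp [eq_of_edgeIncMatrix_transpose_mulVec_eq_zero hG hf a hG.nonempty.some]
  have h4 := (edgeIncMatrix G).rank_transpose
  rw [Matrix.rank, Matrix.rank] at h4
  rw [Module.finrank_fintype_fun_eq_card] at h1 h2
  omega

theorem edgeIncMatrix_mulVec_triangle {G : SimpleGraph V} [DecidableRel G.Adj] {a b c : V}
    (hab : G.Adj a b) (hbc : G.Adj b c) (hca : G.Adj c a) :
    edgeIncMatrix G *ᵥ (Pi.single ⟨s(a, b), hab⟩ 1 + Pi.single ⟨s(b, c), hbc⟩ 1 +
      Pi.single ⟨s(c, a), hca⟩ 1) = 0 := by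
  ext x
  have h1 := hab.ne
  have h2 := hbc.ne
  have h3 := hca.ne
  simp only [mulVec_add, mulVec_single_one, Pi.add_apply, col_apply, Pi.zero_apply,
    edgeIncMatrix, submatrix_apply, id, incMatrix_apply', mk'_mem_incidenceSet_iff, hab, hbc, hca,
    true_and]
  by_cases ha : x = a
  · subst ha; simp [h1, h3.symm, CharTwo.add_self_eq_zero]
  by_cases hb : x = b
  · subst hb; simp [ha, h2, CharTwo.add_self_eq_zero]
  by_cases hc : x = c
  · subst hc; simp [ha, hb, CharTwo.add_self_eq_zero]
  simp [ha, hb, hc]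

/-- Write `L = N Nᵀ`. If `L f = 0`, then `Nᵀ f` lies in the cycle space, a line containing the
triangle. If it were nonzero, the triangle would be a multiple of it; but the entries of `Nᵀ f` on
the three edges sum to `0`, those of the triangle to `3 = 1`. -/
theorem eq_of_lapMatrix_mulVec_eq_zero_of_triangle {G : SimpleGraph V} [DecidableRel G.Adj]
    (hG : G.Connected) (hcard : Fintype.card G.edgeSet = Fintype.card V) {a b c : V}
    (hab : G.Adj a b) (hbc : G.Adj b c) (hca : G.Adj c a) (f : V → ZMod 2)
    (hf : G.lapMatrix (ZMod 2) *ᵥ f = 0) : ∀ x y, f x = f y := by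
  apply eq_of_edgeIncMatrix_transpose_mulVec_eq_zero hG
  by_contra h
  rw [← edgeIncMatrix_mul_transpose, ← mulVec_mulVec] at hf
  set t : G.edgeSet → ZMod 2 := Pi.single ⟨s(a, b), hab⟩ 1 + Pi.single ⟨s(b, c), hbc⟩ 1 +
      Pi.single ⟨s(c, a), hca⟩ 1 with ht
  have h1 : (⟨(edgeIncMatrix G)ᵀ *ᵥ f, hf⟩ : (edgeIncMatrix G).mulVecLin.ker) ≠ 0 :=
    fun h0 ↦ h (congrArg Subtype.val h0)
  obtain ⟨k, hk⟩ := (finrank_eq_one_iff_of_nonzero' _ h1).mp (finrank_ker_edgeIncMatrix hG hcard)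
    ⟨t, edgeIncMatrix_mulVec_triangle hab hbc hca⟩
  have hk : k • ((edgeIncMatrix G)ᵀ *ᵥ f) = t := congrArg Subtype.val hk
  have hne1 : (⟨s(a, b), hab⟩ : G.edgeSet) ≠ ⟨s(b, c), hbc⟩ :=
    fun h ↦ absurd (congrArg Subtype.val h) (by simp [hab.ne, hbc.ne, hca.ne'])
  have hne2 : (⟨s(b, c), hbc⟩ : G.edgeSet) ≠ ⟨s(c, a), hca⟩ :=
    fun h ↦ absurd (congrArg Subtype.val h) (by simp [hab.ne', hbc.ne, hca.ne])
  have hne3 : (⟨s(c, a), hca⟩ : G.edgeSet) ≠ ⟨s(a, b), hab⟩ :=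
    fun h ↦ absurd (congrArg Subtype.val h) (by simp [hab.ne, hbc.ne', hca.ne])
  have e1 := congrFun hk ⟨s(a, b), hab⟩
  have e2 := congrFun hk ⟨s(b, c), hbc⟩
  have e3 := congrFun hk ⟨s(c, a), hca⟩
  rw [Pi.smul_apply, edgeIncMatrix_transpose_mulVec] at e1 e2 e3
  simp only [ht, Pi.add_apply, Pi.single_apply, hne1, hne2, hne3, hne1.symm,
    hne2.symm, hne3.symm, if_true, if_false, smul_eq_mul] at e1 e2 e3
  generalize f a = x at *
  generalize f b = y at *
  generalize f c = z at *
  clear * - e1 e2 e3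
  revert x y z k
  decide

theorem no_triangle_of_det_groundedLapMatrix_eq_zero {G : SimpleGraph V} [DecidableRel G.Adj]
    (hG : G.Connected) (hcard : Fintype.card G.edgeSet = Fintype.card V) {v : V}
    (h : (groundedLapMatrix (ZMod 2) G v).det = 0) {a b c : V} (hab : G.Adj a b)
    (hbc : G.Adj b c) : ¬ G.Adj c a := fun hca ↦
  det_groundedLapMatrix_ne_zero G v
    (eq_of_lapMatrix_mulVec_eq_zero_of_triangle hG hcard hab hbc hca) h

end Triangle

/-! ### Spectral moments and the degree sequence -/

section Traces

variable {V W : Type*} [Fintype V] [Fintype W] [DecidableEq V] [DecidableEq W]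

theorem trace_lapMatrix (G : SimpleGraph V) [DecidableRel G.Adj] :
    (G.lapMatrix ℝ).trace = ∑ v, (G.degree v : ℝ) := by
  simp [lapMatrix, degMatrix, trace]

theorem trace_degMatrix_pow_mul (G : SimpleGraph V) [DecidableRel G.Adj] (k : ℕ)
    (M : Matrix V V ℝ) :
    (G.degMatrix ℝ ^ k * M).trace = ∑ v, (G.degree v : ℝ) ^ k * M v v := by
  simp [degMatrix, diagonal_pow, trace, diagonal_mul]

theorem trace_lapMatrix_sq (G : SimpleGraph V) [DecidableRel G.Adj] :
    (G.lapMatrix ℝ ^ 2).trace = ∑ v, ((G.degree v : ℝ) ^ 2 + G.degree v) := by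
  have e : G.lapMatrix ℝ ^ 2 = G.degMatrix ℝ ^ 2 * 1 - G.degMatrix ℝ ^ 1 * G.adjMatrix ℝ -
      G.adjMatrix ℝ * G.degMatrix ℝ + G.degMatrix ℝ ^ 0 * (G.adjMatrix ℝ * G.adjMatrix ℝ) := by
    rw [lapMatrix]
    noncomm_ring
  rw [e, trace_add, trace_sub, trace_sub, Matrix.trace_mul_comm (G.adjMatrix ℝ),
    ← pow_one (G.degMatrix ℝ)]
  simp only [← pow_mul, trace_degMatrix_pow_mul, adjMatrix_mul_self_apply_self]
  simp [Finset.sum_add_distrib]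

theorem trace_adjMatrix_cube_eq_zero {G : SimpleGraph V} [DecidableRel G.Adj]
    (h : ∀ a b c, G.Adj a b → G.Adj b c → ¬ G.Adj c a) : (G.adjMatrix ℝ ^ 3).trace = 0 := by
  refine Finset.sum_eq_zero fun a _ ↦ ?_
  rw [diag_apply, pow_succ, mul_apply]
  refine Finset.sum_eq_zero fun c _ ↦ ?_
  rw [pow_two, mul_apply, Finset.sum_mul]
  refine Finset.sum_eq_zero fun b _ ↦ ?_
  have := h a b c
  simp only [adjMatrix_apply]
  split_ifs <;> simp_all

theorem trace_lapMatrix_cube {G : SimpleGraph V} [DecidableRel G.Adj]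
    (h : ∀ a b c, G.Adj a b → G.Adj b c → ¬ G.Adj c a) :
    (G.lapMatrix ℝ ^ 3).trace = ∑ v, ((G.degree v : ℝ) ^ 3 + 3 * (G.degree v : ℝ) ^ 2) := by
  set D := G.degMatrix ℝ with hD
  set A := G.adjMatrix ℝ with hA
  -- The expansion of `(D - A) ^ 3`, grouped so that cyclicity of the trace brings each mixed term
  -- to the form `D ^ k * M`.
  have e : G.lapMatrix ℝ ^ 3 = D ^ 3 * 1 - D ^ 2 * A - D * (A * D) - (A * D) * D + D ^ 1 * (A * A) +
      A * (D * A) + (A * A) * D - A ^ 3 := by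
    rw [lapMatrix]
    noncomm_ring
  have t1 : (D * (A * D)).trace = (D ^ 2 * A).trace := by
    rw [Matrix.trace_mul_comm, mul_assoc, Matrix.trace_mul_comm, pow_two]
  have t2 : ((A * D) * D).trace = (D ^ 2 * A).trace := by
    rw [mul_assoc, Matrix.trace_mul_comm, pow_two]
  have t3 : (A * (D * A)).trace = (D ^ 1 * (A * A)).trace := by
    rw [Matrix.trace_mul_comm, mul_assoc, pow_one]
  have t4 : ((A * A) * D).trace = (D ^ 1 * (A * A)).trace := by
    rw [Matrix.trace_mul_comm, pow_one]
  rw [e, trace_sub, trace_add, trace_add, trace_add, trace_sub, trace_sub, trace_sub, t1, t2, t3,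
    t4, trace_adjMatrix_cube_eq_zero h]
  simp only [hD, trace_degMatrix_pow_mul, hA, adjMatrix_mul_self_apply_self]
  simp only [adjMatrix_apply, SimpleGraph.irrefl, if_false, mul_zero, Finset.sum_const_zero,
    one_apply_eq, mul_one, Finset.sum_add_distrib, ← Finset.mul_sum, ← pow_succ]
  ring

theorem trace_lapMatrix_pow_eq {G : SimpleGraph V} {K : SimpleGraph W} [DecidableRel G.Adj]
    [DecidableRel K.Adj] (h : (G.lapMatrix ℝ).charpoly = (K.lapMatrix ℝ).charpoly) (k : ℕ) :
    (G.lapMatrix ℝ ^ k).trace = (K.lapMatrix ℝ ^ k).trace := by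
  rw [(G.isHermitian_lapMatrix ℝ).trace_pow_eq_sum_roots, h,
    ← (K.isHermitian_lapMatrix ℝ).trace_pow_eq_sum_roots]

theorem sum_degree_eq_of_charpoly_eq {G : SimpleGraph V} {K : SimpleGraph W} [DecidableRel G.Adj]
    [DecidableRel K.Adj] (h : (G.lapMatrix ℝ).charpoly = (K.lapMatrix ℝ).charpoly) :
    ∑ v, G.degree v = ∑ w, K.degree w := by
  have := trace_lapMatrix_pow_eq h 1
  rw [pow_one, pow_one, trace_lapMatrix, trace_lapMatrix] at this
  exact_mod_cast this

/-- The coefficients come from writing `(d - 1) (d - k) ^ 2` as a combination of `d ^ 3 + 3 d ^ 2`,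
`d ^ 2 + d`, `d` and `1`. -/
theorem sum_cubic_degree {G : SimpleGraph V} [DecidableRel G.Adj]
    (h : ∀ a b c, G.Adj a b → G.Adj b c → ¬ G.Adj c a) (k : ℝ) :
    ∑ v, ((G.degree v : ℝ) - 1) * ((G.degree v : ℝ) - k) ^ 2 =
      (G.lapMatrix ℝ ^ 3).trace - (2 * k + 4) * (G.lapMatrix ℝ ^ 2).trace +
        (k + 2) ^ 2 * (G.lapMatrix ℝ ^ 1).trace - k ^ 2 * Fintype.card V := by
  have hc : k ^ 2 * Fintype.card V = ∑ _v : V, k ^ 2 := by simp [mul_comm]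
  rw [trace_lapMatrix_cube h, trace_lapMatrix_sq, pow_one, trace_lapMatrix, hc, Finset.mul_sum,
    Finset.mul_sum, ← Finset.sum_sub_distrib, ← Finset.sum_add_distrib, ← Finset.sum_sub_distrib]
  refine Finset.sum_congr rfl fun v _ ↦ ?_
  ring

theorem degree_eq_one_or_of_charpoly_eq {G : SimpleGraph V} {K : SimpleGraph W}
    [DecidableRel G.Adj] [DecidableRel K.Adj]
    (h : (G.lapMatrix ℝ).charpoly = (K.lapMatrix ℝ).charpoly)
    (hG : ∀ a b c, G.Adj a b → G.Adj b c → ¬ G.Adj c a)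
    (hK : ∀ a b c, K.Adj a b → K.Adj b c → ¬ K.Adj c a) {k : ℕ}
    (hKk : ∀ w, K.degree w = 1 ∨ K.degree w = k) (hG1 : ∀ v, 1 ≤ G.degree v) (v : V) :
    G.degree v = 1 ∨ G.degree v = k := by
  have h0 : ∑ v, ((G.degree v : ℝ) - 1) * ((G.degree v : ℝ) - k) ^ 2 = 0 := by
    rw [sum_cubic_degree hG, trace_lapMatrix_pow_eq h, trace_lapMatrix_pow_eq h,
      trace_lapMatrix_pow_eq h, card_eq_of_charpoly_eq h, ← sum_cubic_degree hK]
    refine Finset.sum_eq_zero fun w _ ↦ ?_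
    obtain hw | hw := hKk w <;> simp [hw]
  have hnn : ∀ v ∈ Finset.univ, 0 ≤ ((G.degree v : ℝ) - 1) * ((G.degree v : ℝ) - k) ^ 2 :=
    fun v _ ↦ mul_nonneg (sub_nonneg.mpr (by exact_mod_cast hG1 v)) (sq_nonneg _)
  have := (Finset.sum_eq_zero_iff_of_nonneg hnn).mp h0 v (Finset.mem_univ v)
  rw [mul_eq_zero, sq_eq_zero_iff, sub_eq_zero, sub_eq_zero] at this
  exact_mod_cast this

end Traces

/-! ### Eliminating the leaves; the product of the leaf counts -/

section Leaves

variable {V W : Type*} [Fintype V] [Fintype W] [DecidableEq V] [DecidableEq W]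

/-- The number of neighbours of degree one. -/
def leafCount (G : SimpleGraph V) [DecidableRel G.Adj] (v : V) : ℕ :=
  (Finset.univ.filter fun w ↦ G.degree w = 1 ∧ G.Adj v w).card

/-- The matrix whose determinant is the characteristic polynomial at `1 + y` of the Laplacian matrix,
up to powers of `y`, after elimination of the vertices of degree one. -/
def leafSchurMatrix (G : SimpleGraph V) [DecidableRel G.Adj] (y : ℝ) :
    Matrix {v // ¬ G.degree v = 1} {v // ¬ G.degree v = 1} ℝ :=
  y • toBlock (scalar V (1 + y) - G.lapMatrix ℝ) (fun v ↦ ¬ G.degree v = 1)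
    (fun v ↦ ¬ G.degree v = 1) -
      diagonal fun v : {v // ¬ G.degree v = 1} ↦ (leafCount G v : ℝ)

theorem eq_of_adj_of_degree_eq_one {V : Type*} [Fintype V] {G : SimpleGraph V} [DecidableRel G.Adj] {s u v : V}
    (hs : G.degree s = 1) (hu : G.Adj s u) (hv : G.Adj s v) : u = v :=
  (degree_eq_one_iff_existsUnique_adj.mp hs).unique hu hv

/-- A Schur complement: at `1 + y` the block of the leaves is `y • 1`, because leaves have degree
one and are pairwise nonadjacent. The product of the off-diagonal blocks is diagonal, because a leaf
has only one neighbour. -/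
theorem det_leafSchurMatrix {G : SimpleGraph V} [DecidableRel G.Adj]
    (h : ∀ a b, G.degree a = 1 → G.degree b = 1 → ¬ G.Adj a b) (y : ℝ) :
    (G.lapMatrix ℝ).charpoly.eval (1 + y) * y ^ Fintype.card {v // ¬ G.degree v = 1} =
      y ^ Fintype.card {v // G.degree v = 1} * (leafSchurMatrix G y).det := by
  set p : V → Prop := fun v ↦ G.degree v = 1
  set M := scalar V (1 + y) - G.lapMatrix ℝ with hM
  have hMne : ∀ i j, i ≠ j → M i j = if G.Adj i j then 1 else 0 := by
    intro i j hij
    simp [hM, lapMatrix, degMatrix, hij, adjMatrix_apply]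
  have hA : toBlock M p p = y • 1 := by
    ext ⟨i, hi⟩ ⟨j, hj⟩
    rw [toBlock_apply]
    obtain rfl | hij := eq_or_ne i j
    · have hi' : G.degree i = 1 := hi
      simp [hM, lapMatrix, degMatrix, hi']
    · simp [hMne i j hij, h i j hi hj, one_apply, hij]
  have hB : toBlock M (fun v ↦ ¬ p v) p * toBlock M p (fun v ↦ ¬ p v) =
      diagonal fun v : {v // ¬ p v} ↦ (leafCount G v : ℝ) := by
    have hne : ∀ {i j}, ¬ p i → p j → i ≠ j := fun hi hj hij ↦ hi (hij ▸ hj)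
    ext ⟨i, hi⟩ ⟨j, hj⟩
    rw [mul_apply]
    have e : ∀ s : {v // p v}, toBlock M (fun v ↦ ¬ p v) p ⟨i, hi⟩ s *
        toBlock M p (fun v ↦ ¬ p v) s ⟨j, hj⟩ = if G.Adj i s ∧ G.Adj s j then 1 else 0 := by
      intro s
      rw [toBlock_apply, toBlock_apply, hMne _ _ (hne hi s.2), hMne _ _ (hne hj s.2).symm]
      split_ifs <;> simp_all
    rw [Finset.sum_congr rfl fun s _ ↦ e s]
    obtain rfl | hij := eq_or_ne i j
    · rw [diagonal_apply_eq, ← Finset.sum_subtype (Finset.univ.filter p) (by simp)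
        fun s ↦ if G.Adj i s ∧ G.Adj s i then (1 : ℝ) else 0, Finset.sum_boole, leafCount,
        Finset.filter_filter]
      simp only [G.adj_comm _ i, and_self, p]
    · rw [diagonal_apply_ne _ (by simpa using hij)]
      refine Finset.sum_eq_zero fun s _ ↦ if_neg ?_
      rintro ⟨h1, h2⟩
      exact hij (eq_of_adj_of_degree_eq_one s.2 h1.symm h2)
  have hmul : fromBlocks (toBlock M p p) (toBlock M p fun v ↦ ¬ p v) (toBlock M (fun v ↦ ¬ p v) p)
      (toBlock M (fun v ↦ ¬ p v) fun v ↦ ¬ p v) *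
      fromBlocks 1 (-toBlock M p fun v ↦ ¬ p v) 0 (y • 1) =
      fromBlocks (y • 1) 0 (toBlock M (fun v ↦ ¬ p v) p) (leafSchurMatrix G y) := by
    rw [fromBlocks_multiply, hA, Matrix.mul_neg, Matrix.mul_neg, hB]
    congr 1
    · simp
    · simp
    · simp
    · rw [Matrix.mul_smul, mul_one, neg_add_eq_sub]
      rfl
  have hdet := congrArg det hmul
  rw [det_mul, det_fromBlocks_zero₂₁, det_fromBlocks_zero₁₂, ← det_toBlock, det_one, det_smul,
    det_smul, det_one, det_one, one_mul, mul_one, mul_one] at hdet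
  rw [eval_charpoly]
  exact hdet

theorem continuous_det_leafSchurMatrix (G : SimpleGraph V) [DecidableRel G.Adj] :
    Continuous fun y ↦ (leafSchurMatrix G y).det := by
  refine Continuous.matrix_det (continuous_matrix fun i j ↦ ?_)
  simp only [leafSchurMatrix, Matrix.sub_apply, Matrix.smul_apply, toBlock_apply, scalar_apply,
    diagonal_apply]
  split_ifs <;> fun_prop

theorem det_leafSchurMatrix_zero (G : SimpleGraph V) [DecidableRel G.Adj] :
    (leafSchurMatrix G 0).det = (-1) ^ Fintype.card {v // ¬ G.degree v = 1} *
      ∏ v : {v // ¬ G.degree v = 1}, (leafCount G v : ℝ) := by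
  rw [leafSchurMatrix, zero_smul, zero_sub, det_neg, det_diagonal]

theorem prod_leafCount_eq {G : SimpleGraph V} {K : SimpleGraph W} [DecidableRel G.Adj]
    [DecidableRel K.Adj] (h : (G.lapMatrix ℝ).charpoly = (K.lapMatrix ℝ).charpoly)
    (hG : ∀ a b, G.degree a = 1 → G.degree b = 1 → ¬ G.Adj a b)
    (hK : ∀ a b, K.degree a = 1 → K.degree b = 1 → ¬ K.Adj a b)
    (hcard : Fintype.card {v // ¬ G.degree v = 1} = Fintype.card {w // ¬ K.degree w = 1}) :
    ∏ v : {v // ¬ G.degree v = 1}, leafCount G v = ∏ w : {w // ¬ K.degree w = 1}, leafCount K w := by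
  have hcard' : Fintype.card {v // G.degree v = 1} = Fintype.card {w // K.degree w = 1} := by
    have h1 := Fintype.card_subtype_compl fun v ↦ G.degree v = 1
    have h2 := Fintype.card_subtype_compl fun w ↦ K.degree w = 1
    have h3 := Fintype.card_subtype_le fun v ↦ G.degree v = 1
    have h4 := Fintype.card_subtype_le fun w ↦ K.degree w = 1
    have h5 := card_eq_of_charpoly_eq h
    omega
  -- The powers of `y` cancel only for `y ≠ 0`; continuity reaches `y = 0`, where the determinant is
  -- the product of the leaf counts up to sign.
  have hfun : (fun y ↦ (leafSchurMatrix G y).det) = fun y ↦ (leafSchurMatrix K y).det := by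
    refine Continuous.ext_on (dense_compl_singleton (0 : ℝ)) (continuous_det_leafSchurMatrix G)
      (continuous_det_leafSchurMatrix K) fun y hy ↦ ?_
    have h1 := det_leafSchurMatrix hG y
    rw [h, hcard, det_leafSchurMatrix hK y, hcard'] at h1
    exact (mul_left_cancel₀ (pow_ne_zero _ hy) h1).symm
  have h0 := congrFun hfun 0
  simp only [det_leafSchurMatrix_zero, hcard] at h0
  have := mul_left_cancel₀ (pow_ne_zero _ (by norm_num)) h0
  exact_mod_cast this

theorem sum_leafCount {V : Type*} [Fintype V] {G : SimpleGraph V} [DecidableRel G.Adj]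
    (hG : ∀ a b, G.degree a = 1 → G.degree b = 1 → ¬ G.Adj a b) :
    ∑ v : {v // ¬ G.degree v = 1}, leafCount G v = Fintype.card {v // G.degree v = 1} := by
  have h1 : ∑ v : {v // ¬ G.degree v = 1}, leafCount G v = ∑ v, leafCount G v := by
    rw [← Finset.sum_subtype (Finset.univ.filter fun v ↦ ¬ G.degree v = 1) (by simp)
      (leafCount G)]
    refine Finset.sum_subset (Finset.subset_univ _) fun v _ hv ↦ ?_
    rw [leafCount, Finset.card_eq_zero, Finset.filter_eq_empty_iff]
    rintro w - ⟨hw, hvw⟩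
    exact hG v w (by simpa using hv) hw hvw
  have h2 : ∀ v, leafCount G v =
      ∑ w ∈ Finset.univ.filter (fun w ↦ G.degree w = 1), if G.Adj w v then 1 else 0 := by
    intro v
    rw [leafCount, ← Finset.filter_filter, Finset.card_filter]
    simp only [G.adj_comm]
  rw [h1, Finset.sum_congr rfl fun v _ ↦ h2 v, Finset.sum_comm, Fintype.card_subtype,
    Finset.card_eq_sum_ones]
  refine Finset.sum_congr rfl fun w hw ↦ ?_
  rw [← Nat.cast_id (∑ _, _), ← degree_eq_sum_if_adj]
  simpa using hw

end Leaves

/-- Equality in AM-GM, from the strictness of `log t ≤ t - 1` for `t ≠ 1` at the ratios `x i / p`.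
For `p = 0` the sum alone decides. -/
theorem eq_of_prod_eq_pow_of_sum_eq {ι : Type*} [Fintype ι] {p : ℕ} {x : ι → ℕ}
    (hprod : ∏ i, x i = p ^ Fintype.card ι) (hsum : ∑ i, x i = Fintype.card ι * p) (i : ι) :
    x i = p := by
  obtain rfl | hp := Nat.eq_zero_or_pos p
  · simp only [mul_zero, Finset.sum_eq_zero_iff] at hsum
    exact hsum i (Finset.mem_univ i)
  have hx : ∀ i, 0 < x i := fun i ↦ Nat.pos_of_ne_zero fun h0 ↦ by
    rw [Finset.prod_eq_zero (Finset.mem_univ i) h0] at hprod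
    exact (pow_pos hp _).ne hprod
  have hp' : (0 : ℝ) < p := by exact_mod_cast hp
  have hx' : ∀ i, (0 : ℝ) < x i / p := fun i ↦ div_pos (by exact_mod_cast hx i) hp'
  have h1 : ∑ i, (Real.log (x i / p) - ((x i / p : ℝ) - 1)) = 0 := by
    rw [Finset.sum_sub_distrib, ← Real.log_prod fun i _ ↦ (hx' i).ne', Finset.prod_div_distrib,
      Finset.sum_sub_distrib, ← Finset.sum_div, ← Nat.cast_prod, ← Nat.cast_sum, hprod, hsum]
    simp [hp'.ne']
  by_contra hne
  have h2 : ∑ i, (Real.log (x i / p) - ((x i / p : ℝ) - 1)) < 0 := by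
    refine Finset.sum_neg' (fun j _ ↦ ?_) ⟨i, Finset.mem_univ i, ?_⟩
    · linarith [Real.log_le_sub_one_of_pos (hx' j)]
    · have : (x i / p : ℝ) ≠ 1 := by
        rw [Ne, div_eq_one_iff_eq hp'.ne']
        exact_mod_cast hne
      linarith [Real.log_lt_sub_one_of_pos (hx' i) this]
  exact h2.ne h1

/-! ### Invariants of the jellyfish graph -/

section Jellyfish

variable {p q : ℕ}

theorem jellyfishGraph_adj_none_none {i j : Fin q} :
    (jellyfishGraph p q).Adj (i, none) (j, none) ↔ (cycleGraph q).Adj i j := by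
  simp [jellyfishGraph]

theorem jellyfishGraph_adj_none_some {i j : Fin q} {b : Fin p} :
    (jellyfishGraph p q).Adj (i, none) (j, some b) ↔ i = j := by
  simp [jellyfishGraph]

theorem jellyfishGraph_adj_some_none {i j : Fin q} {b : Fin p} :
    (jellyfishGraph p q).Adj (i, some b) (j, none) ↔ i = j := by
  simp [jellyfishGraph]

theorem jellyfishGraph_adj_some_some {i j : Fin q} {b c : Fin p} :
    ¬ (jellyfishGraph p q).Adj (i, some b) (j, some c) := by
  simp [jellyfishGraph]

theorem degree_cycleGraph (hq : 3 ≤ q) (i : Fin q) : (cycleGraph q).degree i = 2 := by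
  obtain ⟨n, rfl⟩ : ∃ n, q = n + 3 := ⟨q - 3, by omega⟩
  exact cycleGraph_degree_three_le

theorem sum_neighborFinset_eq_sum_ite {V R : Type*} [Fintype V] [AddCommMonoid R]
    (G : SimpleGraph V) [DecidableRel G.Adj] (f : V → R) (v : V) :
    ∑ u ∈ G.neighborFinset v, f u = ∑ u, if G.Adj v u then f u else 0 := by
  rw [← Finset.sum_filter, neighborFinset_eq_filter]

theorem connected_jellyfishGraph (hq : 3 ≤ q) : (jellyfishGraph p q).Connected := by
  have hnone : ∀ i j : Fin q, (jellyfishGraph p q).Reachable (i, none) (j, none) := by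
    intro i j
    let f : cycleGraph q →g jellyfishGraph p q :=
      ⟨fun i ↦ (i, none), fun h ↦ jellyfishGraph_adj_none_none.mpr h⟩
    exact (cycleGraph_preconnected i j).map f
  have hx : ∀ x : Fin q × Option (Fin p), (jellyfishGraph p q).Reachable x (x.1, none) := by
    rintro ⟨i, _ | b⟩
    · rfl
    · exact (jellyfishGraph_adj_some_none.mpr rfl).reachable
  exact { preconnected := fun x y ↦ (hx x).trans ((hnone _ _).trans (hx y).symm)
          nonempty := ⟨(⟨0, by omega⟩, none)⟩ }

theorem no_triangle_jellyfishGraph (hqe : Even q) (x y z : Fin q × Option (Fin p))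
    (hxy : (jellyfishGraph p q).Adj x y) (hyz : (jellyfishGraph p q).Adj y z) :
    ¬ (jellyfishGraph p q).Adj z x := by
  let c := cycleGraph.bicoloring_of_even q hqe
  -- A proper 2-colouring: alternate along the even cycle and give each pendant vertex the colour
  -- opposite to its centre.
  let d : Fin q × Option (Fin p) → Bool := fun x ↦ xor (c x.1) x.2.isSome
  have hd : ∀ x y, (jellyfishGraph p q).Adj x y → d x ≠ d y := by
    rintro ⟨i, _ | a⟩ ⟨j, _ | b⟩ h
    · simpa [d] using c.valid (jellyfishGraph_adj_none_none.mp h)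
    · simp [d, jellyfishGraph_adj_none_some.mp h]
    · simp [d, jellyfishGraph_adj_some_none.mp h]
    · exact absurd h jellyfishGraph_adj_some_some
  intro hzx
  have h1 := hd _ _ hxy
  have h2 := hd _ _ hyz
  have h3 := hd _ _ hzx
  revert h1 h2 h3
  generalize d x = a
  generalize d y = b
  generalize d z = c
  revert a b c
  decide

variable [DecidableRel (jellyfishGraph p q).Adj]

theorem sum_neighborFinset_jellyfishGraph_none {R : Type*} [NonAssocSemiring R]
    (f : Fin q → R) (i : Fin q) :
    ∑ u ∈ (jellyfishGraph p q).neighborFinset (i, none), f u.1 =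
      ∑ j ∈ (cycleGraph q).neighborFinset i, f j + p * f i := by
  rw [sum_neighborFinset_eq_sum_ite, sum_neighborFinset_eq_sum_ite, Fintype.sum_prod_type]
  simp [Fintype.sum_option, jellyfishGraph_adj_none_none, jellyfishGraph_adj_none_some,
    Finset.sum_add_distrib]

theorem sum_neighborFinset_jellyfishGraph_some {R : Type*} [NonAssocSemiring R]
    (f : Fin q → R) (i : Fin q) (b : Fin p) :
    ∑ u ∈ (jellyfishGraph p q).neighborFinset (i, some b), f u.1 = f i := by
  rw [sum_neighborFinset_eq_sum_ite, Fintype.sum_prod_type]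
  simp [Fintype.sum_option, jellyfishGraph_adj_some_none, jellyfishGraph_adj_some_some]

theorem degree_jellyfishGraph_none (hq : 3 ≤ q) (i : Fin q) :
    (jellyfishGraph p q).degree (i, none) = p + 2 := by
  have := sum_neighborFinset_jellyfishGraph_none (p := p) (fun _ ↦ 1) i
  simp only [Finset.sum_const, card_neighborFinset_eq_degree, degree_cycleGraph hq] at this
  simp at this
  omega

theorem degree_jellyfishGraph_some (i : Fin q) (b : Fin p) :
    (jellyfishGraph p q).degree (i, some b) = 1 := by
  have := sum_neighborFinset_jellyfishGraph_some (p := p) (fun _ ↦ 1) i b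
  rwa [Finset.sum_const, card_neighborFinset_eq_degree, smul_eq_mul, mul_one] at this

theorem degree_jellyfishGraph_eq_or (hq : 3 ≤ q) (x : Fin q × Option (Fin p)) :
    (jellyfishGraph p q).degree x = 1 ∨ (jellyfishGraph p q).degree x = p + 2 := by
  obtain ⟨i, _ | b⟩ := x
  · exact Or.inr (degree_jellyfishGraph_none hq i)
  · exact Or.inl (degree_jellyfishGraph_some i b)

theorem sum_degree_jellyfishGraph (hq : 3 ≤ q) :
    ∑ x, (jellyfishGraph p q).degree x = 2 * (q * (p + 1)) := by
  rw [Fintype.sum_prod_type]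
  simp only [Fintype.sum_option, degree_jellyfishGraph_none hq, degree_jellyfishGraph_some]
  simp
  ring

theorem leafCount_jellyfishGraph_none (hq : 3 ≤ q) (i : Fin q) :
    leafCount (jellyfishGraph p q) (i, none) = p := by
  rw [leafCount, Finset.card_filter, Fintype.sum_prod_type]
  simp only [Fintype.sum_option, degree_jellyfishGraph_none hq, degree_jellyfishGraph_some,
    jellyfishGraph_adj_none_some]
  simp

/-- Modulo two, the alternating 0-1 colouring of the cycle, extended constantly along each star, is
in the Laplacian kernel. It is `1` at cycle vertex `0` and `0` at cycle vertex `1`, the grounded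
one. -/
theorem det_groundedLapMatrix_jellyfishGraph (hq : 3 ≤ q) (hqe : Even q) :
    (groundedLapMatrix (ZMod 2) (jellyfishGraph p q) (⟨1, by omega⟩, none)).det = 0 := by
  let c := cycleGraph.bicoloring_of_even q hqe
  let g : Fin q → ZMod 2 := fun i ↦ if c i then 1 else 0
  have hc : ∀ i, c i = decide (i.val % 2 = 0) := fun _ ↦ rfl
  have hg : ∀ i j, (cycleGraph q).Adj i j → g j = 1 + g i := by
    intro i j h
    have := c.valid h
    simp only [g]
    revert this
    generalize c i = a
    generalize c j = b
    revert a b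
    decide
  refine det_groundedLapMatrix_eq_zero _ _ (f := fun x ↦ g x.1) (fun h ↦ ?_) ?_ ?_
  · have := congrFun h (⟨0, by omega⟩, none)
    simp [g, hc] at this
  · ext ⟨i, _ | b⟩
    · rw [lapMatrix_mulVec_apply, sum_neighborFinset_jellyfishGraph_none,
        degree_jellyfishGraph_none hq,
        Finset.sum_congr rfl fun j hj ↦ hg i j ((mem_neighborFinset _ _ _).mp hj),
        Finset.sum_const, card_neighborFinset_eq_degree, degree_cycleGraph hq, CharTwo.two_nsmul]
      have h2 : (2 : ZMod 2) = 0 := rfl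
      push_cast
      rw [h2]
      simp
    · rw [lapMatrix_mulVec_apply, sum_neighborFinset_jellyfishGraph_some,
        degree_jellyfishGraph_some]
      simp
  · simp [g, hc]

end Jellyfish

/-! ### Connected 2-regular graphs are cycles -/

section Regular

variable {U V : Type*} [Fintype U] [Fintype V]

theorem adj_iff_of_bijective_of_degree_eq {F : SimpleGraph U} {C : SimpleGraph V}
    [DecidableRel F.Adj] [DecidableRel C.Adj] (f : F →g C) (hf : Function.Injective f)
    (hdeg : ∀ u, C.degree (f u) = F.degree u) (a b : U) : C.Adj (f a) (f b) ↔ F.Adj a b := by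
  refine ⟨fun h ↦ ?_, fun h ↦ f.map_adj h⟩
  have hsub : (F.neighborFinset a).map ⟨f, hf⟩ ⊆ C.neighborFinset (f a) := by
    intro x hx
    obtain ⟨y, hy, rfl⟩ := Finset.mem_map.mp hx
    exact (mem_neighborFinset _ _ _).mpr (f.map_adj ((mem_neighborFinset _ _ _).mp hy))
  have heq := Finset.eq_of_subset_of_card_le hsub (by
    rw [Finset.card_map, card_neighborFinset_eq_degree, card_neighborFinset_eq_degree, hdeg])
  have hb : f b ∈ (F.neighborFinset a).map ⟨f, hf⟩ := heq ▸ (mem_neighborFinset _ _ _).mpr h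
  obtain ⟨y, hy, hyb⟩ := Finset.mem_map.mp hb
  rw [← hf hyb]
  exact (mem_neighborFinset _ _ _).mp hy

theorem nonempty_cycleGraph_iso {q : ℕ} (hq : 3 ≤ q) {C : SimpleGraph V} [DecidableRel C.Adj]
    (hconn : C.Connected) (hreg : ∀ v, C.degree v = 2) (hcard : Fintype.card V = q) :
    Nonempty (cycleGraph q ≃g C) := by
  classical
  have hcyc : C.IsCycles := fun v _ ↦ by
    rw [Set.ncard_eq_toFinset_card', ← hreg v]
    rfl
  obtain ⟨v⟩ := hconn.nonempty
  have hne : (C.neighborSet v).Nonempty :=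
    (C.degree_pos_iff_exists_adj v).mp (by rw [hreg]; norm_num)
  -- In a 2-regular graph some cycle fills the component of `v`, here all of `C`, so it has length
  -- `q` and gives an injective copy of `C_q`.
  obtain ⟨w, hw, hverts⟩ := hcyc.exists_cycle_toSubgraph_verts_eq_connectedComponentSupp
    (c := C.connectedComponentMk v) rfl hne
  have hmem : ∀ x, x ∈ w.support.tail := by
    intro x
    have hx : x ∈ w.toSubgraph.verts := by
      rw [hverts]
      exact ConnectedComponent.sound (hconn.preconnected x v)
    rw [Walk.mem_verts_toSubgraph, Walk.mem_support_iff] at hx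
    obtain rfl | hx := hx
    · exact Walk.end_mem_tail_support hw.not_nil
    · exact hx
  have hlen : w.length = q := by
    have h1 := List.toFinset_card_of_nodup hw.support_nodup
    have h2 : w.support.tail.toFinset = Finset.univ := by
      ext x
      simp [hmem x]
    rw [h2, Finset.card_univ, hcard, List.length_tail, Walk.length_support] at h1
    omega
  obtain ⟨f⟩ := (cycleGraph_isContained_iff hq).mpr ⟨v, w, hw, hlen⟩
  have hbij : Function.Bijective f.toHom :=
    (Fintype.bijective_iff_injective_and_card _).mpr ⟨f.injective', by simp [hcard]⟩
  exact ⟨⟨Equiv.ofBijective _ hbij, fun {a b} ↦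
    adj_iff_of_bijective_of_degree_eq f.toHom f.injective'
      (fun u ↦ by rw [hreg, degree_cycleGraph hq]) a b⟩⟩

end Regular

/-! ### The core and reconstruction of the jellyfish graph -/

section Core

variable {V : Type*} [Fintype V]

/-- The subgraph induced by the vertices of degree different from one. -/
abbrev coreGraph (G : SimpleGraph V) [DecidableRel G.Adj] :
    SimpleGraph {v // ¬ G.degree v = 1} :=
  G.comap Subtype.val

theorem leafCount_add_degree_coreGraph (G : SimpleGraph V) [DecidableRel G.Adj]
    (v : {v // ¬ G.degree v = 1}) :
    leafCount G v + (coreGraph G).degree v = G.degree v := by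
  have h := (coreGraph G).degree_eq_sum_if_adj (R := ℕ) v
  have h' : ∑ w ∈ Finset.univ.filter (fun w ↦ ¬ G.degree w = 1), (if G.Adj v w then 1 else 0) =
      ∑ w : {w // ¬ G.degree w = 1}, if G.Adj v w then 1 else 0 :=
    Finset.sum_subtype _ (by simp) _
  simp only [comap_adj, Nat.cast_id] at h
  rw [h, ← h', ← Nat.cast_id (G.degree v), G.degree_eq_sum_if_adj (R := ℕ) v, leafCount,
    ← Finset.filter_filter, Finset.card_filter, Finset.sum_filter_add_sum_filter_not]

/-- Two adjacent leaves would form a whole component, leaving only two vertices. -/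
theorem not_adj_of_degree_eq_one {G : SimpleGraph V} [DecidableRel G.Adj] (hconn : G.Connected)
    (hcard : 3 ≤ Fintype.card V) (a b : V) (ha : G.degree a = 1) (hb : G.degree b = 1) :
    ¬ G.Adj a b := by
  classical
  intro hab
  have key : ∀ x y, G.Walk x y → (x = a ∨ x = b) → (y = a ∨ y = b) := by
    intro x y w
    induction w with
    | nil => exact id
    | cons h _ ih =>
      rintro (rfl | rfl)
      · exact ih (Or.inr (eq_of_adj_of_degree_eq_one ha h hab))
      · exact ih (Or.inl (eq_of_adj_of_degree_eq_one hb h hab.symm))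
  have hsub : (Finset.univ : Finset V) ⊆ {a, b} := by
    intro y _
    obtain ⟨w⟩ := hconn.preconnected a y
    simpa using key a y w (Or.inl rfl)
  have := (Finset.card_le_card hsub).trans Finset.card_le_two
  rw [Finset.card_univ] at this
  omega

theorem coreGraph_connected {G : SimpleGraph V} [DecidableRel G.Adj] (hconn : G.Connected)
    (hleaf : ∀ a b, G.degree a = 1 → G.degree b = 1 → ¬ G.Adj a b)
    (hne : Nonempty {v // ¬ G.degree v = 1}) : (coreGraph G).Connected := by
  -- A retraction onto the core: a leaf goes to its neighbour, so each edge goes to an edge or to a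
  -- single vertex.
  have hr : ∀ v : V, ∃ u : {v // ¬ G.degree v = 1}, v = u.1 ∨ (G.degree v = 1 ∧ G.Adj v u) := by
    intro v
    by_cases hv : G.degree v = 1
    · obtain ⟨u, hu, -⟩ := degree_eq_one_iff_existsUnique_adj.mp hv
      exact ⟨⟨u, fun h ↦ hleaf v u hv h hu⟩, Or.inr ⟨hv, hu⟩⟩
    · exact ⟨⟨v, hv⟩, Or.inl rfl⟩
  choose r hr using hr
  have hadj : ∀ x y, G.Adj x y → (coreGraph G).Reachable (r x) (r y) := by
    intro x y hxy
    obtain hx | ⟨hx, hx'⟩ := hr x <;> obtain hy | ⟨hy, hy'⟩ := hr y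
    · refine Adj.reachable ?_
      rw [comap_adj, ← hx, ← hy]
      exact hxy
    · have : r x = r y := Subtype.ext (hx.symm.trans (eq_of_adj_of_degree_eq_one hy hxy.symm hy'))
      rw [this]
    · have : r x = r y := Subtype.ext ((eq_of_adj_of_degree_eq_one hx hx' hxy).trans hy)
      rw [this]
    · exact absurd hxy (hleaf x y hx hy)
  have hwalk : ∀ x y, G.Walk x y → (coreGraph G).Reachable (r x) (r y) := by
    intro x y w
    induction w with
    | nil => rfl
    | cons h _ ih => exact (hadj _ _ h).trans ih
  have hrid : ∀ u : {v // ¬ G.degree v = 1}, r u = u := by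
    intro u
    obtain h | ⟨h, -⟩ := hr u
    · exact Subtype.ext h.symm
    · exact absurd h u.2
  refine { preconnected := fun u v ↦ ?_, nonempty := hne }
  obtain ⟨w⟩ := hconn.preconnected u v
  have := hwalk _ _ w
  rwa [hrid, hrid] at this

theorem card_core_of_sum_degree {G : SimpleGraph V} [DecidableRel G.Adj] {p q : ℕ}
    (hdeg : ∀ v, G.degree v = 1 ∨ G.degree v = p + 2)
    (hsum : ∑ v, G.degree v = 2 * (q * (p + 1))) (hcard : Fintype.card V = q * (p + 1)) :
    Fintype.card {v // ¬ G.degree v = 1} = q := by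
  have h : ∀ v, G.degree v = 1 + (p + 1) * if ¬ G.degree v = 1 then 1 else 0 := by
    intro v
    obtain h | h := hdeg v
    · simp [h]
    · simp [h]
      ring
  rw [Finset.sum_congr rfl fun v _ ↦ h v, Finset.sum_add_distrib, ← Finset.mul_sum,
    ← Finset.card_filter, ← Fintype.card_subtype] at hsum
  simp only [Finset.sum_const, Finset.card_univ, hcard, smul_eq_mul, mul_one] at hsum
  have : (p + 1) * Fintype.card {v // ¬ G.degree v = 1} = (p + 1) * q := by linarith
  exact Nat.eq_of_mul_eq_mul_left (Nat.succ_pos p) this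

theorem nonempty_jellyfishGraph_iso {G : SimpleGraph V} [DecidableRel G.Adj] {p q : ℕ}
    (hq : 3 ≤ q) (hconn : G.Connected)
    (hdeg : ∀ v, G.degree v = 1 ∨ G.degree v = p + 2)
    (hleaf : ∀ a b, G.degree a = 1 → G.degree b = 1 → ¬ G.Adj a b)
    (hcore : Fintype.card {v // ¬ G.degree v = 1} = q)
    (hcount : ∀ v : {v // ¬ G.degree v = 1}, leafCount G v = p) :
    Nonempty (jellyfishGraph p q ≃g G) := by
  have hne : Nonempty {v // ¬ G.degree v = 1} :=
    Fintype.card_pos_iff.mp (by rw [hcore]; omega)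
  obtain ⟨e⟩ := nonempty_cycleGraph_iso hq (coreGraph_connected hconn hleaf hne)
    (fun v ↦ by
      have h1 := leafCount_add_degree_coreGraph G v
      have h2 := (hdeg v).resolve_left v.2
      rw [hcount] at h1
      omega) hcore
  have hl : ∀ i, Nonempty (Fin p ≃ {w // G.degree w = 1 ∧ G.Adj (e i) w}) := fun i ↦
    ⟨(Fintype.equivFinOfCardEq (by rw [Fintype.card_subtype]; exact hcount (e i))).symm⟩
  let l := fun i ↦ (hl i).some
  let F : Fin q × Option (Fin p) → V := fun x ↦ x.2.elim (e x.1 : V) fun b ↦ (l x.1 b : V)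
  have hinj : Function.Injective F := by
    rintro ⟨i, _ | a⟩ ⟨j, _ | b⟩ h
    · have : i = j := e.injective (Subtype.ext h)
      rw [this]
    · exact absurd ((congrArg (G.degree ·) h).trans (l j b).2.1) (e i).2
    · exact absurd ((congrArg (G.degree ·) h.symm).trans (l i a).2.1) (e j).2
    · have h : (l i a : V) = l j b := h
      have hij : i = j := e.injective (Subtype.ext
        (eq_of_adj_of_degree_eq_one (l i a).2.1 (l i a).2.2.symm (h ▸ (l j b).2.2.symm)))
      subst hij
      rw [(l i).injective (Subtype.ext h)]
  have hsurj : Function.Surjective F := by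
    intro v
    by_cases hv : G.degree v = 1
    · obtain ⟨u, hu, -⟩ := degree_eq_one_iff_existsUnique_adj.mp hv
      obtain ⟨i, hi⟩ := e.surjective ⟨u, fun h ↦ hleaf v u hv h hu⟩
      obtain ⟨b, hb⟩ := (l i).surjective ⟨v, hv, by rw [hi]; exact hu.symm⟩
      exact ⟨(i, some b), congrArg Subtype.val hb⟩
    · obtain ⟨i, hi⟩ := e.surjective ⟨v, hv⟩
      exact ⟨(i, none), congrArg Subtype.val hi⟩
  have hnl : ∀ i j b, G.Adj (e i) (l j b) ↔ i = j := by
    refine fun i j b ↦ ⟨fun h ↦ ?_, fun h ↦ h ▸ (l i _).2.2⟩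
    exact e.injective (Subtype.ext
      (eq_of_adj_of_degree_eq_one (l j b).2.1 h.symm (l j b).2.2.symm))
  refine ⟨⟨Equiv.ofBijective F ⟨hinj, hsurj⟩, fun {x y} ↦ ?_⟩⟩
  obtain ⟨i, _ | a⟩ := x <;> obtain ⟨j, _ | b⟩ := y
  · exact (e.map_adj_iff).trans jellyfishGraph_adj_none_none.symm
  · exact (hnl i j b).trans jellyfishGraph_adj_none_some.symm
  · exact (G.adj_comm _ _).trans ((hnl j i a).trans (eq_comm.trans
      jellyfishGraph_adj_some_none.symm))
  · exact iff_of_false (hleaf _ _ (l i a).2.1 (l j b).2.1) jellyfishGraph_adj_some_some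

end Core

/-! ### Spectral characterisation of the jellyfish graph and passage to complements -/

theorem nonempty_jellyfishGraph_iso_of_lCospectral {p q : ℕ} (hq : 3 ≤ q) (hqe : Even q)
    {V : Type*} [Fintype V] {G : SimpleGraph V} (h : LCospectral G (jellyfishGraph p q)) :
    Nonempty (jellyfishGraph p q ≃g G) := by
  classical
  rw [lCospectral_iff_charpoly_eq] at h
  have hconnJ := connected_jellyfishGraph (p := p) hq
  have hconn := connected_of_charpoly_eq h hconnJ
  have hcardJ : Fintype.card (Fin q × Option (Fin p)) = q * (p + 1) := by simp
  have hcard := (card_eq_of_charpoly_eq h).trans hcardJ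
  have hsumJ := sum_degree_jellyfishGraph (p := p) hq
  have hsum := (sum_degree_eq_of_charpoly_eq h).trans hsumJ
  have hthree : 3 ≤ q * (p + 1) := hq.trans (Nat.le_mul_of_pos_right q (Nat.succ_pos p))
  have hedge : Fintype.card G.edgeSet = Fintype.card V := by
    have := G.sum_degrees_eq_twice_card_edges
    rw [hsum, edgeFinset_card] at this
    omega
  have hdet : (groundedLapMatrix (ZMod 2) G hconn.nonempty.some).det = 0 := by
    rw [det_groundedLapMatrix_eq h, det_groundedLapMatrix_jellyfishGraph hq hqe]
  have htri : ∀ a b c, G.Adj a b → G.Adj b c → ¬ G.Adj c a := fun a b c ↦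
    no_triangle_of_det_groundedLapMatrix_eq_zero hconn hedge hdet
  have : Nontrivial V := Fintype.one_lt_card_iff_nontrivial.mp (by omega)
  have hdeg := degree_eq_one_or_of_charpoly_eq h htri (no_triangle_jellyfishGraph hqe)
    (degree_jellyfishGraph_eq_or hq) fun v ↦ hconn.preconnected.degree_pos_of_nontrivial v
  have hleaf := not_adj_of_degree_eq_one hconn (by omega)
  have hleafJ := not_adj_of_degree_eq_one hconnJ (by omega)
  have hcore := card_core_of_sum_degree hdeg hsum hcard
  have hcoreJ := card_core_of_sum_degree (degree_jellyfishGraph_eq_or hq) hsumJ hcardJ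
  have hcountJ : ∀ x : {x // ¬ (jellyfishGraph p q).degree x = 1},
      leafCount (jellyfishGraph p q) x = p := by
    rintro ⟨⟨i, _ | b⟩, hx⟩
    · exact leafCount_jellyfishGraph_none hq i
    · exact absurd (degree_jellyfishGraph_some i b) hx
  refine nonempty_jellyfishGraph_iso hq hconn hdeg hleaf hcore
    (eq_of_prod_eq_pow_of_sum_eq (x := fun v : {v // ¬ G.degree v = 1} ↦ leafCount G v) ?_ ?_)
  · rw [prod_leafCount_eq h hleaf hleafJ (hcore.trans hcoreJ.symm),
      Finset.prod_congr rfl fun x _ ↦ hcountJ x, Finset.prod_const, Finset.card_univ, hcore, hcoreJ]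
  · rw [sum_leafCount hleaf]
    have h1 := Fintype.card_subtype_compl fun v ↦ G.degree v = 1
    have h2 := Fintype.card_subtype_le fun v ↦ G.degree v = 1
    rw [hcore, hcard, mul_add] at h1
    rw [hcard, mul_add] at h2
    rw [hcore]
    omega

theorem mainTheorem3 (p q : ℕ) (hq : 3 ≤ q) (hqe : Even q)
    {V : Type u} [Fintype V] (H : SimpleGraph V)
    (hH : LCospectral H (jellyfishGraph p q)) :
    IsDLS.{u, v} Hᶜ := by
  intro W _ K hK
  have hKc : LCospectral Kᶜ H := by simpa using hK.compl
  obtain ⟨e⟩ := nonempty_jellyfishGraph_iso_of_lCospectral hq hqe hH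
  obtain ⟨f⟩ := nonempty_jellyfishGraph_iso_of_lCospectral hq hqe (hKc.trans hH)
  have g : Kᶜ ≃g H := f.symm.trans e
  refine ⟨⟨g.toEquiv, fun {a b} ↦ ?_⟩⟩
  have hadj : H.Adj (g a) (g b) ↔ Kᶜ.Adj a b := g.map_adj_iff
  change Hᶜ.Adj (g a) (g b) ↔ K.Adj a b
  rw [compl_adj, hadj, compl_adj, g.injective.ne_iff]
  exact ⟨fun h ↦ by_contra fun h' ↦ h.2 ⟨h.1, h'⟩, fun h ↦ ⟨h.ne, fun h' ↦ h'.2 h⟩⟩
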